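/- Let $D=\{z\in\mathbb C:|z|<1\}$ and, for $0<p<\infty$, let $H^p$ be the Hardy space of all holomorphic functions $f$ on $D$ with $\sup_{0<r<1}\int_0^{2\pi}|f(re^{i\theta})|^p\,d\theta<\infty$. Endow $H^p$ with its usual metric: $d_p(f,g)=\sup_{0<r<1}\int_0^{2\pi}|f(re^{i\theta})-g(re^{i\theta})|^p\,d\theta$ if $0<p\le 1$, and the $p$-th root of this quantity if $p\ge 1$. Theorem. Let $0<p<q<\infty$. Then $(H^p\setminus H^q)\cup\{0\}$ contains a complex vector space that is dense in $H^p$. -/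

import Mathlib

open Set MeasureTheory
open scoped ENNReal Complex.UnitDisc

noncomputable section

namespace HardyDisc

/-- A function on the open unit disc `𝔻` is holomorphic if it is the restriction to `𝔻` of a
function on `ℂ` that is complex differentiable at every point of the open unit ball. -/
def IsHolomorphic (f : 𝔻 → ℂ) : Prop :=
  ∃ F : ℂ → ℂ, DifferentiableOn ℂ F (Metric.ball 0 1) ∧ ∀ z : 𝔻, f z = F z

/-- The point `r e^{iθ}` of the open unit disc, for `0 < r < 1`. -/
def circlePoint (r : Ioo (0 : ℝ) 1) (θ : ℝ) : 𝔻 :=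
  Complex.UnitDisc.mk ((r : ℝ) * Complex.exp (θ * Complex.I)) (by
    rw [norm_mul, Complex.norm_exp_ofReal_mul_I, mul_one, Complex.norm_real, Real.norm_eq_abs,
      abs_of_pos r.2.1]
    exact r.2.2)

/-- `∫_0^{2π} |f(r e^{iθ})|^p dθ`, as an element of `[0, ∞]`. -/
def circleMean (p : ℝ) (f : 𝔻 → ℂ) (r : Ioo (0 : ℝ) 1) : ℝ≥0∞ :=
  ∫⁻ θ in Ioc 0 (2 * Real.pi), ‖f (circlePoint r θ)‖ₑ ^ p

/-- `sup_{0 < r < 1} ∫_0^{2π} |f(r e^{iθ})|^p dθ`, as an element of `[0, ∞]`. -/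
def supMean (p : ℝ) (f : 𝔻 → ℂ) : ℝ≥0∞ :=
  ⨆ r : Ioo (0 : ℝ) 1, circleMean p f r

/-- The distance of `f` to `0` in the usual metric of `H^p`: it is
`sup_r ∫_0^{2π} |f(r e^{iθ})|^p dθ` for `0 < p ≤ 1`, and the `p`-th root of this for `p ≥ 1`. -/
def gaugeH (p : ℝ) (f : 𝔻 → ℂ) : ℝ≥0∞ :=
  supMean p f ^ min 1 p⁻¹

theorem continuous_circlePoint (r : Ioo (0 : ℝ) 1) : Continuous (circlePoint r) := by
  rw [Complex.UnitDisc.isEmbedding_coe.continuous_iff]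
  change Continuous fun θ : ℝ => ((r : ℝ) : ℂ) * Complex.exp (θ * Complex.I)
  fun_prop

theorem IsHolomorphic.continuous {f : 𝔻 → ℂ} (hf : IsHolomorphic f) : Continuous f := by
  obtain ⟨F, hF, h⟩ := hf
  have : f = fun z : 𝔻 => F z := funext h
  rw [this]
  exact hF.continuousOn.comp_continuous Complex.UnitDisc.continuous_coe
    fun z => mem_ball_zero_iff.2 z.norm_lt_one

theorem IsHolomorphic.zero : IsHolomorphic 0 :=
  ⟨0, differentiableOn_const 0, fun _ => rfl⟩

theorem IsHolomorphic.add {f g : 𝔻 → ℂ} (hf : IsHolomorphic f) (hg : IsHolomorphic g) :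
    IsHolomorphic (f + g) := by
  obtain ⟨F, hF, h⟩ := hf
  obtain ⟨G, hG, h'⟩ := hg
  exact ⟨F + G, hF.add hG, fun z => by simp [h, h']⟩

theorem IsHolomorphic.smul {f : 𝔻 → ℂ} (c : ℂ) (hf : IsHolomorphic f) :
    IsHolomorphic (c • f) := by
  obtain ⟨F, hF, h⟩ := hf
  exact ⟨c • F, hF.const_smul c, fun z => by simp [h]⟩

theorem gaugeH_eq_iSup {p : ℝ} (hp : 0 < p) (f : 𝔻 → ℂ) :
    gaugeH p f = ⨆ r, circleMean p f r ^ min 1 p⁻¹ :=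
  (ENNReal.orderIsoRpow (min 1 p⁻¹) (lt_min one_pos (inv_pos.2 hp))).map_iSup _

theorem gaugeH_lt_top_iff {p : ℝ} (hp : 0 < p) (f : 𝔻 → ℂ) : gaugeH p f < ∞ ↔ supMean p f < ∞ :=
  ENNReal.rpow_lt_top_iff_of_pos (lt_min one_pos (inv_pos.2 hp))

theorem circleMean_zero {p : ℝ} (hp : 0 < p) (r : Ioo (0 : ℝ) 1) : circleMean p 0 r = 0 := by
  simp [circleMean, hp]

theorem gaugeH_zero {p : ℝ} (hp : 0 < p) : gaugeH p 0 = 0 := by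
  simp [gaugeH_eq_iSup hp, circleMean_zero hp, hp]

theorem gaugeH_neg (p : ℝ) (f : 𝔻 → ℂ) : gaugeH p (-f) = gaugeH p f := by
  simp [gaugeH, supMean, circleMean]

theorem supMean_smul {p : ℝ} (hp : 0 < p) (c : ℂ) (f : 𝔻 → ℂ) :
    supMean p (c • f) = ‖c‖ₑ ^ p * supMean p f := by
  have hc : ‖c‖ₑ ^ p ≠ ∞ := ENNReal.rpow_ne_top_of_nonneg hp.le enorm_ne_top
  simp only [supMean, circleMean, ENNReal.mul_iSup, Pi.smul_apply, smul_eq_mul, enorm_mul,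
    ENNReal.mul_rpow_of_nonneg _ _ hp.le]
  exact iSup_congr fun r => lintegral_const_mul' _ _ hc

theorem gaugeH_add_le {p : ℝ} (hp : 0 < p) {f g : 𝔻 → ℂ} (hf : Continuous f)
    (hg : Continuous g) : gaugeH p (f + g) ≤ gaugeH p f + gaugeH p g := by
  rw [gaugeH_eq_iSup hp (f + g)]
  refine iSup_le fun r => ?_
  have key : circleMean p (f + g) r ^ min 1 p⁻¹ ≤
      circleMean p f r ^ min 1 p⁻¹ + circleMean p g r ^ min 1 p⁻¹ := by
    have mf : Measurable fun θ => ‖f (circlePoint r θ)‖ₑ :=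
      (hf.comp (continuous_circlePoint r)).enorm.measurable
    have mg : Measurable fun θ => ‖g (circlePoint r θ)‖ₑ :=
      (hg.comp (continuous_circlePoint r)).enorm.measurable
    have hle : circleMean p (f + g) r ≤ ∫⁻ θ in Ioc 0 (2 * Real.pi),
        (‖f (circlePoint r θ)‖ₑ + ‖g (circlePoint r θ)‖ₑ) ^ p :=
      lintegral_mono fun θ => ENNReal.rpow_le_rpow (enorm_add_le _ _) hp.le
    rcases le_total p 1 with h1 | h1
    · rw [min_eq_left ((one_le_inv₀ hp).2 h1)]
      simp only [ENNReal.rpow_one]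
      refine hle.trans ?_
      unfold circleMean
      rw [← lintegral_add_left (mf.pow_const p)]
      exact lintegral_mono fun θ => ENNReal.rpow_add_le_add_rpow _ _ hp.le h1
    · rw [min_eq_right (inv_le_one_of_one_le₀ h1)]
      refine (ENNReal.rpow_le_rpow hle (inv_nonneg.2 hp.le)).trans ?_
      simpa [circleMean] using ENNReal.lintegral_Lp_add_le
        (μ := volume.restrict (Ioc 0 (2 * Real.pi))) mf.aemeasurable mg.aemeasurable h1
  refine key.trans (add_le_add ?_ ?_)
  · rw [gaugeH_eq_iSup hp]
    exact le_iSup (fun r => circleMean p f r ^ min 1 p⁻¹) r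
  · rw [gaugeH_eq_iSup hp]
    exact le_iSup (fun r => circleMean p g r ^ min 1 p⁻¹) r

theorem exists_circlePoint {z : 𝔻} (hz : (z : ℂ) ≠ 0) :
    ∃ r : Ioo (0 : ℝ) 1, ∃ θ ∈ Ioc (0 : ℝ) (2 * Real.pi), circlePoint r θ = z := by
  refine ⟨⟨‖(z : ℂ)‖, norm_pos_iff.2 hz, z.norm_lt_one⟩,
    toIocMod Real.two_pi_pos 0 (Complex.arg z), ?_, ?_⟩
  · simpa using toIocMod_mem_Ioc Real.two_pi_pos 0 (Complex.arg z)
  · apply Complex.UnitDisc.coe_injective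
    change ((‖(z : ℂ)‖ : ℝ) : ℂ) *
      Complex.exp ((toIocMod Real.two_pi_pos 0 (Complex.arg z) : ℝ) * Complex.I) = z
    conv_rhs => rw [← Complex.norm_mul_exp_arg_mul_I (z : ℂ)]
    congr 1
    rw [Complex.exp_eq_exp_iff_exists_int]
    refine ⟨-toIocDiv Real.two_pi_pos 0 (Complex.arg z), ?_⟩
    have := self_sub_toIocDiv_zsmul Real.two_pi_pos 0 (Complex.arg z)
    rw [← this]
    push_cast
    simp
    ring

theorem eq_zero_of_gaugeH_eq_zero {p : ℝ} (hp : 0 < p) {f : 𝔻 → ℂ} (hf : IsHolomorphic f)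
    (h : gaugeH p f = 0) : f = 0 := by
  have hpos : (0 : ℝ) < min 1 p⁻¹ := lt_min one_pos (inv_pos.2 hp)
  have hne : ∀ z : 𝔻, (z : ℂ) ≠ 0 → f z = 0 := by
    intro z hz
    obtain ⟨r, θ, hθ, rfl⟩ := exists_circlePoint hz
    have hs : supMean p f = 0 := (ENNReal.rpow_eq_zero_iff_of_pos hpos).1 h
    have hr : circleMean p f r = 0 := ENNReal.iSup_eq_zero.1 hs r
    have hc : Continuous fun θ => f (circlePoint r θ) :=
      hf.continuous.comp (continuous_circlePoint r)
    have hae := (lintegral_eq_zero_iff (hc.enorm.measurable.pow_const p)).1 hr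
    have hae' : (fun θ => f (circlePoint r θ)) =ᵐ[volume.restrict (Ioc 0 (2 * Real.pi))]
        fun _ => (0 : ℂ) := by
      filter_upwards [hae] with θ hθ
      simpa [hp, hp.le, hp.not_gt] using hθ
    exact Measure.eqOn_Ioc_of_ae_eq volume hae' hc.continuousOn continuousOn_const hθ
  obtain ⟨F, hF, hfF⟩ := hf
  funext z
  by_cases hz : (z : ℂ) = 0
  · have hcont : ContinuousAt F 0 :=
      (hF.differentiableAt (Metric.ball_mem_nhds 0 one_pos)).continuousAt
    have hev : ∀ᶠ w in nhdsWithin (0 : ℂ) {0}ᶜ, F w = 0 := by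
      filter_upwards [self_mem_nhdsWithin,
        mem_nhdsWithin_of_mem_nhds (Metric.ball_mem_nhds (0 : ℂ) one_pos)] with w hw hw1
      have := hne (Complex.UnitDisc.mk w (mem_ball_zero_iff.1 hw1)) hw
      rwa [hfF] at this
    have hlim := hcont.tendsto.mono_left (nhdsWithin_le_nhds (s := {0}ᶜ))
    have h0 : F 0 = 0 := tendsto_nhds_unique hlim
      ((tendsto_const_nhds (x := (0 : ℂ))).congr' (hev.mono fun w hw => hw.symm))
    rw [hfF, hz, h0]
    rfl
  · exact hne z hz

/-- The Hardy space `H^p` of the open unit disc, `0 < p < ∞`: the vector space of the holomorphic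
functions `f` on `𝔻` with `sup_{0 < r < 1} ∫_0^{2π} |f(r e^{iθ})|^p dθ < ∞`. -/
def hardySpace (p : ℝ) (hp : 0 < p) : Submodule ℂ (𝔻 → ℂ) where
  carrier := {f | IsHolomorphic f ∧ supMean p f < ∞}
  add_mem' := by
    rintro f g ⟨hf, hf'⟩ ⟨hg, hg'⟩
    refine ⟨hf.add hg, ?_⟩
    rw [← gaugeH_lt_top_iff hp] at *
    exact (gaugeH_add_le hp hf.continuous hg.continuous).trans_lt (ENNReal.add_lt_top.2 ⟨hf', hg'⟩)
  zero_mem' := ⟨.zero, by simp [← gaugeH_lt_top_iff hp, gaugeH_zero hp]⟩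
  smul_mem' := by
    rintro c f ⟨hf, hf'⟩
    refine ⟨hf.smul c, ?_⟩
    rw [supMean_smul hp]
    exact ENNReal.mul_lt_top (ENNReal.rpow_lt_top_of_nonneg hp.le enorm_ne_top) hf'

/-- `H^p` as a type of its own, which carries only the `H^p` metric below (and not the topology of
pointwise convergence inherited from `𝔻 → ℂ`). -/
def Hardy (p : ℝ) (hp : 0 < p) : Type :=
  hardySpace p hp

/-- The function on the disc that underlies an element of `H^p`. -/
def Hardy.toFun {p : ℝ} {hp : 0 < p} (f : Hardy p hp) : 𝔻 → ℂ :=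
  Subtype.val f

theorem Hardy.holomorphic {p : ℝ} {hp : 0 < p} (f : Hardy p hp) : IsHolomorphic f.toFun :=
  f.2.1

theorem Hardy.sub_mem {p : ℝ} {hp : 0 < p} (f g : Hardy p hp) :
    f.toFun - g.toFun ∈ hardySpace p hp :=
  (hardySpace p hp).sub_mem f.2 g.2

instance Hardy.instEMetricSpace (p : ℝ) (hp : 0 < p) : EMetricSpace (Hardy p hp) where
  edist f g := gaugeH p (f.toFun - g.toFun)
  edist_self f := by simp [gaugeH_zero hp]
  edist_comm f g := by rw [← gaugeH_neg, neg_sub]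
  edist_triangle f g h := by
    rw [← sub_add_sub_cancel f.toFun g.toFun h.toFun]
    exact gaugeH_add_le hp (f.holomorphic.continuous.sub g.holomorphic.continuous)
      (g.holomorphic.continuous.sub h.holomorphic.continuous)
  eq_of_edist_eq_zero {f g} h :=
    Subtype.ext (sub_eq_zero.1 (eq_zero_of_gaugeH_eq_zero hp (f.sub_mem g).1 h))

/-- The metric space `H^p`, with the usual translation invariant metric `d_p`:
`d_p(f, g) = sup_r ∫_0^{2π} |f(r e^{iθ}) - g(r e^{iθ})|^p dθ` for `0 < p ≤ 1`, and the `p`-th root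
of this for `p ≥ 1`. -/
instance Hardy.instMetricSpace (p : ℝ) (hp : 0 < p) : MetricSpace (Hardy p hp) :=
  EMetricSpace.toMetricSpace fun f g => ((gaugeH_lt_top_iff hp _).2 (f.sub_mem g).2).ne

end HardyDisc

end

/-! The space V is an algebraic complement of `H^p ∩ H^q` in `H^p`, so its nonzero elements avoid
`H^q`. Density is forced by the choice of complement. The poles `(1 - z)^{-a}` with `1/q < a < 1/p`
lie in `H^p` (`supMean_onePole_lt_top`) and are independent modulo `H^q`
(`linearIndepOn_mkQ_onePole`). There are continuum many of them, enough to give each pair `(y, n)`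
with `y ∈ H^p ∩ H^q` its own exponent (`exists_injective_mem_Ioo`). Let `w (y, n)` be `y` plus its
pole, scaled to size below `1/(n+1)`. The `w (y, n)` stay independent modulo `H^q`, so some
complement V contains them all. Any `x = v + y`, with `v ∈ V` and `y ∈ H^p ∩ H^q`, is the limit of
`v + w (y, n) ∈ V`. -/

namespace HardyDisc

/-! ### Poles at the boundary point 1 and their membership in `H^p` -/

/-- The branch of `(1 - z)^{-a}` on the unit disc that is `1` at the origin. -/
noncomputable def onePole (a : ℝ) (z : 𝔻) : ℂ :=
  (1 - (z : ℂ)) ^ ((-a : ℝ) : ℂ)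

theorem IsHolomorphic.onePole (a : ℝ) : IsHolomorphic (onePole a) := by
  refine ⟨fun z => (1 - z) ^ ((-a : ℝ) : ℂ), ?_, fun z => rfl⟩
  refine DifferentiableOn.cpow_const (by fun_prop) fun z hz => Or.inl ?_
  have h1 : ‖z‖ < 1 := by simpa using hz
  have h2 := (Complex.abs_re_le_norm z).trans_lt h1
  have h3 := (abs_lt.1 h2).2
  simpa using h3

theorem norm_onePole (a : ℝ) (z : 𝔻) : ‖onePole a z‖ = ‖1 - (z : ℂ)‖ ^ (-a) :=
  Complex.norm_cpow_real _ _

theorem coe_circlePoint (r : Ioo (0 : ℝ) 1) (θ : ℝ) :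
    (circlePoint r θ : ℂ) = (r : ℝ) * Complex.exp (θ * Complex.I) := rfl

theorem norm_coe_circlePoint (r : Ioo (0 : ℝ) 1) (θ : ℝ) : ‖(circlePoint r θ : ℂ)‖ = r := by
  rw [coe_circlePoint, norm_mul, Complex.norm_exp_ofReal_mul_I, mul_one, Complex.norm_real,
    Real.norm_eq_abs, abs_of_pos r.2.1]

theorem norm_one_sub_circlePoint_pos (r : Ioo (0 : ℝ) 1) (θ : ℝ) :
    0 < ‖1 - (circlePoint r θ : ℂ)‖ := by
  have := norm_sub_norm_le (1 : ℂ) (circlePoint r θ)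
  rw [norm_coe_circlePoint, norm_one] at this
  linarith [r.2.2]

theorem norm_one_sub_circlePoint_le (r : Ioo (0 : ℝ) 1) (θ : ℝ) :
    ‖1 - (circlePoint r θ : ℂ)‖ ≤ (1 - r) + |θ| := by
  have h1 : 1 - (circlePoint r θ : ℂ) =
      ((1 - r : ℝ) : ℂ) - (r : ℝ) * (Complex.exp (Complex.I * θ) - 1) := by
    rw [coe_circlePoint, mul_comm Complex.I]; push_cast; ring
  rw [h1]
  refine (norm_sub_le _ _).trans (add_le_add ?_ ?_)
  · rw [Complex.norm_real, Real.norm_eq_abs, abs_of_pos (by linarith [r.2.2])]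
  · rw [norm_mul, Complex.norm_real, Real.norm_eq_abs, abs_of_pos r.2.1]
    have h2 := Real.norm_exp_I_mul_ofReal_sub_one_le (x := θ)
    rw [Real.norm_eq_abs] at h2
    exact (mul_le_of_le_one_left (norm_nonneg _) r.2.2.le).trans h2

/-- With `z = r e^{iθ}`, `2|sin(θ/2)| = |e^{iθ} - 1| ≤ |1 - z| + (1 - r)`, and `1 - r ≤ |1 - z|`. -/
theorem abs_sin_half_le_norm_one_sub_circlePoint (r : Ioo (0 : ℝ) 1) (θ : ℝ) :
    |Real.sin (θ / 2)| ≤ ‖1 - (circlePoint r θ : ℂ)‖ := by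
  have h1 := norm_sub_norm_le (1 : ℂ) (circlePoint r θ)
  rw [norm_coe_circlePoint, norm_one] at h1
  have h2 : Complex.exp (Complex.I * θ) - 1 =
      -(1 - (circlePoint r θ : ℂ)) + ((1 - r : ℝ) : ℂ) * Complex.exp (θ * Complex.I) := by
    rw [coe_circlePoint, mul_comm Complex.I]; push_cast; ring
  have h3 := norm_add_le (-(1 - (circlePoint r θ : ℂ)))
    (((1 - r : ℝ) : ℂ) * Complex.exp (θ * Complex.I))
  rw [← h2, Complex.norm_exp_I_mul_ofReal_sub_one, norm_neg,
    norm_mul (_ : ℂ), Complex.norm_exp_ofReal_mul_I, Complex.norm_real, Real.norm_eq_abs, Real.norm_eq_abs,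
    abs_of_pos (show 0 < 1 - (r : ℝ) by linarith [r.2.2]), abs_mul, abs_two] at h3
  linarith

/-- Jordan's inequality `sin x ≥ 2x/π` bounds `|1 - z|` below by `θ/π` or `(2π - θ)/π`, according to
the half of the circle. The resulting majorant is independent of `r`, and integrable when `s < 1`.
-/
theorem norm_one_sub_circlePoint_rpow_le (r : Ioo (0 : ℝ) 1) {θ s : ℝ}
    (hθ : θ ∈ Ioo 0 (2 * Real.pi)) (hs : 0 ≤ s) :
    ‖1 - (circlePoint r θ : ℂ)‖ ^ (-s) ≤
      Real.pi ^ s * (θ ^ (-s) + (2 * Real.pi - θ) ^ (-s)) := by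
  have hπ := Real.pi_pos
  have key : ∀ x : ℝ, 0 < x → x / Real.pi ≤ ‖1 - (circlePoint r θ : ℂ)‖ →
      ‖1 - (circlePoint r θ : ℂ)‖ ^ (-s) ≤ Real.pi ^ s * x ^ (-s) := by
    intro x hx h
    refine (Real.rpow_le_rpow_of_nonpos (div_pos hx hπ) h (neg_nonpos.2 hs)).trans_eq ?_
    rw [Real.div_rpow hx.le hπ.le, Real.rpow_neg hπ.le, div_inv_eq_mul, mul_comm]
  have hsin := (le_abs_self _).trans (abs_sin_half_le_norm_one_sub_circlePoint r θ)
  have h2 : 0 < 2 * Real.pi - θ := by linarith [hθ.2]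
  have hA : 0 ≤ Real.pi ^ s * θ ^ (-s) := by have := hθ.1; positivity
  have hB : 0 ≤ Real.pi ^ s * (2 * Real.pi - θ) ^ (-s) := by positivity
  rw [mul_add]
  rcases le_total θ Real.pi with h | h
  · have := Real.mul_le_sin (x := θ / 2) (by linarith [hθ.1]) (by linarith)
    have := key θ hθ.1 ((by field_simp : θ / Real.pi = 2 / Real.pi * (θ / 2)).trans_le
      (this.trans hsin))
    linarith
  · have := Real.mul_le_sin (x := Real.pi - θ / 2) (by linarith [hθ.2]) (by linarith)
    rw [Real.sin_pi_sub] at this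
    have := key _ h2 ((by field_simp :
      (2 * Real.pi - θ) / Real.pi = 2 / Real.pi * (Real.pi - θ / 2)).trans_le (this.trans hsin))
    linarith

theorem supMean_onePole_lt_top {a p : ℝ} (ha : 0 ≤ a) (hp : 0 ≤ p) (h : a * p < 1) :
    supMean p (onePole a) < ∞ := by
  set F : ℝ → ℝ := fun θ =>
    Real.pi ^ (a * p) * (θ ^ (-(a * p)) + (2 * Real.pi - θ) ^ (-(a * p))) with hF
  have hint : IntegrableOn F (Ioo 0 (2 * Real.pi)) := by
    have h1 : IntervalIntegrable (fun x : ℝ => x ^ (-(a * p))) volume 0 (2 * Real.pi) :=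
      intervalIntegral.intervalIntegrable_rpow' (by linarith)
    have h2 := h1.comp_sub_left (2 * Real.pi)
    rw [sub_zero, sub_self] at h2
    have h3 := (h1.add h2.symm).const_mul (Real.pi ^ (a * p))
    exact (intervalIntegrable_iff_integrableOn_Ioo_of_le Real.two_pi_pos.le).1 h3
  refine lt_of_le_of_lt (iSup_le fun r => ?_) hint.lintegral_lt_top
  unfold circleMean
  rw [← Measure.restrict_congr_set (Ioo_ae_eq_Ioc (μ := volume) (a := (0 : ℝ))
    (b := 2 * Real.pi))]
  refine setLIntegral_mono_ae' measurableSet_Ioo (ae_of_all _ fun θ hθ => ?_)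
  rw [← ofReal_norm, ENNReal.ofReal_rpow_of_nonneg (norm_nonneg _) hp, norm_onePole,
    ← Real.rpow_mul (norm_nonneg _), neg_mul]
  exact ENNReal.ofReal_le_ofReal
    (norm_one_sub_circlePoint_rpow_le r hθ (mul_nonneg ha hp))

theorem onePole_mem_hardySpace {a p : ℝ} (hp : 0 < p) (ha : 0 ≤ a) (h : a < 1 / p) :
    onePole a ∈ hardySpace p hp :=
  ⟨.onePole a, supMean_onePole_lt_top ha hp.le ((lt_div_iff₀ hp).1 h)⟩

/-! ### Linear independence of the poles modulo `H^q` -/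

/-- A function that grows at least like `|1 - z|^{-a}` at the boundary point `1` does not lie in
`H^q` if `a q ≥ 1`. -/
theorem supMean_eq_top_of_le_norm {a q δ C : ℝ} {f : 𝔻 → ℂ} (hq : 0 < q) (ha : 1 ≤ a * q)
    (hδ : 0 < δ) (hC : 0 < C)
    (hf : ∀ z : 𝔻, ‖1 - (z : ℂ)‖ < δ → C * ‖1 - (z : ℂ)‖ ^ (-a) ≤ ‖f z‖) :
    supMean q f = ∞ := by
  have ha0 : 0 ≤ a := by
    by_contra! h
    nlinarith
  set η : ℝ := min (δ / 2) 1 with hη_def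
  have hη : 0 < η := by positivity
  set K : ℝ := (C * 2 ^ (-a)) ^ q
  have hK : 0 < K := by positivity
  have hle : ∀ n : ℕ, ∫⁻ θ in Ioo (1 / ((n : ℝ) + 2)) η,
      ENNReal.ofReal (K * θ ^ (-(a * q))) ≤ supMean q f := by
    intro n
    have hn : (0 : ℝ) < 1 / ((n : ℝ) + 2) := by positivity
    have hn1 : 1 / ((n : ℝ) + 2) < 1 := by
      rw [div_lt_one (by positivity)]
      linarith [n.cast_nonneg (α := ℝ)]
    -- With this radius, `θ > 1 - r` on the interval of integration, whence `|1 - z| ≤ (1 - r) + θ ≤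
    -- 2θ`. The shift by 2 keeps `r` positive at `n = 0`.
    let r : Ioo (0 : ℝ) 1 := ⟨1 - 1 / ((n : ℝ) + 2), by linarith, by linarith⟩
    refine le_trans ?_ (le_iSup (circleMean q f) r)
    have hsub : Ioo (1 / ((n : ℝ) + 2)) η ⊆ Ioc 0 (2 * Real.pi) := fun θ hθ =>
      ⟨hn.trans hθ.1, by
        have := hθ.2.trans_le (min_le_right (δ / 2) 1)
        linarith [Real.pi_gt_three]⟩
    refine le_trans ?_ (lintegral_mono_set hsub)
    refine setLIntegral_mono_ae' measurableSet_Ioo (ae_of_all _ fun θ hθ => ?_)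
    have hθ0 : 0 < θ := hn.trans hθ.1
    have ht : ‖1 - (circlePoint r θ : ℂ)‖ ≤ 2 * θ := by
      refine (norm_one_sub_circlePoint_le r θ).trans ?_
      rw [abs_of_pos hθ0]
      have : 1 - (r : ℝ) = 1 / ((n : ℝ) + 2) := by simp [r]
      linarith [hθ.1]
    have h1 := hf (circlePoint r θ) (ht.trans_lt (by
      have := hθ.2.trans_le (min_le_left (δ / 2) 1)
      linarith))
    have h2 : C * 2 ^ (-a) * θ ^ (-a) ≤ ‖f (circlePoint r θ)‖ := by
      refine le_trans ?_ h1
      rw [mul_assoc, ← Real.mul_rpow zero_le_two hθ0.le]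
      exact mul_le_mul_of_nonneg_left (Real.rpow_le_rpow_of_nonpos
        (norm_one_sub_circlePoint_pos r θ) ht (neg_nonpos.2 ha0)) hC.le
    rw [← ofReal_norm, ENNReal.ofReal_rpow_of_nonneg (norm_nonneg _) hq.le]
    refine ENNReal.ofReal_le_ofReal (le_trans (le_of_eq ?_)
      (Real.rpow_le_rpow (by positivity) h2 hq.le))
    rw [Real.mul_rpow (by positivity) (by positivity), ← Real.rpow_mul hθ0.le, neg_mul]
  have hunion : ⋃ n : ℕ, Ioo (1 / ((n : ℝ) + 2)) η = Ioo 0 η := by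
    ext θ
    simp only [mem_iUnion, mem_Ioo]
    constructor
    · rintro ⟨n, h1, h2⟩
      exact ⟨lt_trans (by positivity) h1, h2⟩
    · rintro ⟨h1, h2⟩
      obtain ⟨n, hn⟩ := exists_nat_one_div_lt h1
      refine ⟨n, lt_of_le_of_lt ?_ hn, h2⟩
      gcongr
      norm_num
  have hmono : Monotone fun n : ℕ => Ioo (1 / ((n : ℝ) + 2)) η := by
    intro m n hmn
    refine Ioo_subset_Ioo_left ?_
    gcongr
  have hall : ∫⁻ θ in Ioo 0 η, ENNReal.ofReal (K * θ ^ (-(a * q))) ≤ supMean q f := by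
    rw [← hunion, setLIntegral_iUnion_of_directed _ hmono.directed_le]
    exact iSup_le hle
  -- A finite supremum would make `θ^{-aq}` integrable at 0, contradicting `a q ≥ 1`.
  by_contra hne
  have hfin := hall.trans_lt (lt_top_iff_ne_top.2 hne)
  have hint : IntegrableOn (fun θ : ℝ => K * θ ^ (-(a * q))) (Ioo 0 η) := by
    refine (lintegral_ofReal_ne_top_iff_integrable ?_ ?_).1 hfin.ne
    · fun_prop
    · filter_upwards [ae_restrict_mem measurableSet_Ioo] with θ hθ
      have := hθ.1
      simp only [Pi.zero_apply]
      positivity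
  have hint' : IntegrableOn (fun θ : ℝ => θ ^ (-(a * q))) (Ioo 0 η) := by
    simpa [IntegrableOn, ← mul_assoc, hK.ne'] using hint.const_mul K⁻¹
  have := (intervalIntegral.integrableOn_Ioo_rpow_iff hη).1 hint'
  linarith

/-- The term with the largest exponent dominates a sum of poles at `1`. -/
theorem exists_le_norm_smul_onePole_add_sum {a : ℝ} {s : Finset ℝ} (hs : ∀ b ∈ s, b < a)
    (c : ℝ → ℂ) (hc : c a ≠ 0) :
    ∃ δ > 0, ∀ z : 𝔻, ‖1 - (z : ℂ)‖ < δ → ‖c a‖ / 2 * ‖1 - (z : ℂ)‖ ^ (-a) ≤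
      ‖(c a • onePole a + ∑ b ∈ s, c b • onePole b) z‖ := by
  -- Relative to `t^{-a}`, the remaining terms have size `t^{a-b}`, which vanishes at 0 because `b <
  -- a`.
  have hlim : Filter.Tendsto (fun t : ℝ => ∑ b ∈ s, ‖c b‖ * t ^ (a - b)) (nhds 0) (nhds 0) := by
    rw [← Finset.sum_const_zero (s := s)]
    refine tendsto_finsetSum _ fun b hb => ?_
    have h1 : Filter.Tendsto (fun t : ℝ => t ^ (a - b)) (nhds 0) (nhds 0) := by
      have := (Real.continuousAt_rpow_const 0 (a - b) (Or.inr (sub_pos.2 (hs b hb)).le)).tendsto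
      rwa [Real.zero_rpow (sub_pos.2 (hs b hb)).ne'] at this
    simpa using h1.const_mul ‖c b‖
  obtain ⟨δ, hδ, h⟩ := Metric.eventually_nhds_iff.1
    (hlim.eventually_lt_const (show 0 < ‖c a‖ / 2 by positivity))
  refine ⟨δ, hδ, fun z hz => ?_⟩
  have ht : 0 < ‖1 - (z : ℂ)‖ := by
    have := norm_sub_norm_le (1 : ℂ) z
    rw [norm_one] at this
    linarith [z.norm_lt_one]
  set t := ‖1 - (z : ℂ)‖
  have hsum : ‖∑ b ∈ s, c b * onePole b z‖ ≤ ‖c a‖ / 2 * t ^ (-a) := by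
    calc ‖∑ b ∈ s, c b * onePole b z‖ ≤ ∑ b ∈ s, ‖c b‖ * t ^ (-b) :=
          norm_sum_le_of_le _ fun b _ => by rw [norm_mul, norm_onePole]
      _ = (∑ b ∈ s, ‖c b‖ * t ^ (a - b)) * t ^ (-a) := by
          rw [Finset.sum_mul]
          refine Finset.sum_congr rfl fun b _ => ?_
          rw [mul_assoc, ← Real.rpow_add ht]
          ring_nf
      _ ≤ ‖c a‖ / 2 * t ^ (-a) :=
          mul_le_mul_of_nonneg_right (h (by simpa [abs_of_pos ht] using hz)).le (by positivity)
  have hval : (c a • onePole a + ∑ b ∈ s, c b • onePole b) z =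
      c a * onePole a z + ∑ b ∈ s, c b * onePole b z := by
    simp
  have hlow := norm_sub_le_norm_add (c a * onePole a z) (∑ b ∈ s, c b * onePole b z)
  rw [hval]
  rw [norm_mul, norm_onePole] at hlow
  linarith

/-- The largest exponent governs the growth at 1, so its coefficient must vanish; removing that term
gives an induction on the maximum. -/
theorem eq_zero_of_supMean_sum_onePole_lt_top {q : ℝ} (hq : 0 < q) (s : Finset ℝ) (c : ℝ → ℂ)
    (hs : ∀ a ∈ s, 1 / q ≤ a) (h : supMean q (∑ a ∈ s, c a • onePole a) < ∞) :
    ∀ a ∈ s, c a = 0 := by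
  induction s using Finset.induction_on_max with
  | empty => simp
  | insert a s hmax ih =>
    have ha : a ∉ s := fun h => (hmax a h).false
    rw [Finset.sum_insert ha] at h
    have hca : c a = 0 := by
      by_contra hca
      obtain ⟨δ, hδ, hle⟩ := exists_le_norm_smul_onePole_add_sum hmax c hca
      exact h.ne (supMean_eq_top_of_le_norm hq
        ((div_le_iff₀ hq).1 (hs a (Finset.mem_insert_self a s))) hδ (by positivity) hle)
    rw [hca, zero_smul, zero_add] at h
    intro b hb
    rcases Finset.mem_insert.1 hb with rfl | hb
    · exact hca
    · exact ih (fun b hb => hs b (Finset.mem_insert_of_mem hb)) h b hb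

/-- The functions `(1 - z)^{-a}` with `1 / q ≤ a` are linearly independent modulo `H^q`. -/
theorem linearIndepOn_mkQ_onePole {q : ℝ} (hq : 0 < q) :
    LinearIndepOn ℂ (fun a => (hardySpace q hq).mkQ (onePole a)) (Ici (1 / q)) := by
  rw [linearIndepOn_iff_linearIndepOn_finset]
  intro s hs
  rw [linearIndepOn_finset_iff]
  intro c h
  simp only [← map_smul, ← map_sum] at h
  rw [Submodule.mkQ_apply, Submodule.Quotient.mk_eq_zero] at h
  exact eq_zero_of_supMean_sum_onePole_lt_top hq s c (fun a ha => hs ha) h.2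

/-! ### Small scalars and the supply of exponents -/

/-- The scalar is a unit so that rescaling preserves linear independence. -/
theorem exists_smul_gaugeH_lt {p : ℝ} (hp : 0 < p) {f : 𝔻 → ℂ} (hf : supMean p f < ∞) {ε : ℝ≥0∞}
    (hε : 0 < ε) : ∃ c : ℂˣ, gaugeH p ((c : ℂ) • f) < ε := by
  have hm : (0 : ℝ) < min 1 p⁻¹ := lt_min one_pos (inv_pos.2 hp)
  have hlim : Filter.Tendsto (fun c : ℂ => gaugeH p (c • f)) (nhds 0) (nhds 0) := by
    simp only [gaugeH, supMean_smul hp]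
    have h1 : Filter.Tendsto (fun c : ℂ => ‖c‖ₑ ^ p) (nhds 0) (nhds 0) := by
      have := ((ENNReal.continuous_rpow_const (y := p)).comp continuous_enorm).tendsto (0 : ℂ)
      simpa [hp, Function.comp_def] using this
    have h2 := ENNReal.Tendsto.mul_const h1 (Or.inr hf.ne)
    rw [zero_mul] at h2
    have h3 := (ENNReal.continuous_rpow_const (y := min 1 p⁻¹)).tendsto 0
    rw [ENNReal.zero_rpow_of_pos hm] at h3
    exact h3.comp h2
  obtain ⟨c, hc, hc0⟩ := (((hlim.mono_left nhdsWithin_le_nhds).eventually_lt_const hε).and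
    (self_mem_nhdsWithin (s := ({0} : Set ℂ)ᶜ))).exists
  exact ⟨Units.mk0 c hc0, hc⟩

/-- A continuous function is determined by its values on a dense sequence. -/
theorem mk_isHolomorphic_le_continuum :
    Cardinal.mk {f : 𝔻 → ℂ // IsHolomorphic f} ≤ Cardinal.continuum := by
  have : SecondCountableTopology 𝔻 :=
    Complex.UnitDisc.isEmbedding_coe.secondCountableTopology
  let φ : {f : 𝔻 → ℂ // IsHolomorphic f} → ℕ → ℂ := fun f n =>
    f.1 (TopologicalSpace.denseSeq 𝔻 n)
  have hφ : Function.Injective φ := by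
    intro f g h
    refine Subtype.ext (f.2.continuous.ext_on (TopologicalSpace.denseRange_denseSeq 𝔻)
      g.2.continuous ?_)
    rintro _ ⟨n, rfl⟩
    exact congrFun h n
  refine (Cardinal.mk_le_of_injective hφ).trans ?_
  simp

theorem exists_injective_mem_Ioo {p q : ℝ} (hp : 0 < p) (hpq : p < q)
    (S : Submodule ℂ (hardySpace p hp)) :
    ∃ e : S × ℕ → ℝ, Function.Injective e ∧ ∀ i, e i ∈ Ioo (1 / q) (1 / p) := by
  have hlt : 1 / q < 1 / p := one_div_lt_one_div_of_lt hp hpq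
  have hS : Cardinal.mk S ≤ Cardinal.continuum :=
    (Cardinal.mk_le_of_injective (f := fun y : S =>
      (⟨y.1.1, y.1.2.1⟩ : {f : 𝔻 → ℂ // IsHolomorphic f}))
      fun y z h => Subtype.ext (Subtype.ext (Subtype.mk.inj h))).trans
      mk_isHolomorphic_le_continuum
  have hcard : Cardinal.mk (S × ℕ) ≤ Cardinal.mk (Ioo (1 / q) (1 / p)) := by
    rw [Cardinal.mk_Ioo_real hlt, Cardinal.mk_prod, Cardinal.lift_id, Cardinal.mk_nat,
      Cardinal.lift_id, ← Cardinal.continuum_mul_aleph0]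
    exact mul_le_mul_left hS _
  obtain ⟨e⟩ := hcard
  exact ⟨fun i => e i, Subtype.val_injective.comp e.injective, fun i => (e i).2⟩

end HardyDisc

/-! ### Construction of the dense complement -/

theorem theorem9 (p q : ℝ) (hp : 0 < p) (hpq : p < q) :
    ∃ V : Submodule ℂ (𝔻 → ℂ),
      (V : Set (𝔻 → ℂ)) ⊆
        ((HardyDisc.hardySpace p hp : Set (𝔻 → ℂ)) \
          (HardyDisc.hardySpace q (hp.trans hpq) : Set (𝔻 → ℂ))) ∪ {0} ∧
      Dense {f : HardyDisc.Hardy p hp | f.toFun ∈ V} := by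
  set X := HardyDisc.hardySpace p hp
  set Y := HardyDisc.hardySpace q (hp.trans hpq)
  -- The kernel of `π` is `H^p ∩ H^q`.
  let π : X →ₗ[ℂ] (𝔻 → ℂ) ⧸ Y := Y.mkQ ∘ₗ X.subtype
  have hπ : ∀ x : X, x ∈ LinearMap.ker π ↔ (x : 𝔻 → ℂ) ∈ Y := fun x => by simp [π]
  obtain ⟨e, he, hmem⟩ := HardyDisc.exists_injective_mem_Ioo hp hpq (LinearMap.ker π)
  have hX : ∀ i, HardyDisc.onePole (e i) ∈ X := fun i =>
    HardyDisc.onePole_mem_hardySpace hp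
      ((one_div_pos.2 (hp.trans hpq)).trans (hmem i).1).le (hmem i).2
  have hc : ∀ i : LinearMap.ker π × ℕ, ∃ c : ℂˣ,
      HardyDisc.gaugeH p ((c : ℂ) • HardyDisc.onePole (e i)) < ((i.2 : ℝ≥0∞) + 1)⁻¹ := fun i =>
    HardyDisc.exists_smul_gaugeH_lt hp (hX i).2 (by simp)
  choose c hc using hc
  let g : LinearMap.ker π × ℕ → X := fun i => (c i : ℂ) • ⟨HardyDisc.onePole (e i), hX i⟩
  let w : LinearMap.ker π × ℕ → X := fun i => i.1 + g i
  have hw : LinearIndependent ℂ (π ∘ w) := by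
    have h1 : LinearIndependent ℂ fun i => Y.mkQ (HardyDisc.onePole (e i)) :=
      (HardyDisc.linearIndepOn_mkQ_onePole (hp.trans hpq)).comp
        (fun i => (⟨e i, (hmem i).1.le⟩ : Ici (1 / q)))
        fun i j h => he (congrArg Subtype.val h)
    -- Adding `i.1 ∈ ker π` does not change the class modulo `H^q`, so `π ∘ w` is a rescaled family
    -- of pole classes.
    convert h1.units_smul c using 1
    funext i
    have h2 : π i.1 = 0 := i.1.2
    simp only [Function.comp_apply, w, map_add, h2, zero_add, g, map_smul, Pi.smul_apply']
    rfl
  -- Independence of the images makes the span of `w` meet `ker π` only in 0, so it extends to a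
  -- complement.
  obtain ⟨V, hwV, hV⟩ := (Submodule.range_ker_disjoint hw).exists_isCompl
  have hdense : ∀ (x : X) (ε : ℝ≥0∞), 0 < ε →
      ∃ u ∈ V, HardyDisc.gaugeH p ((x : 𝔻 → ℂ) - (u : 𝔻 → ℂ)) < ε := by
    intro x ε hε
    obtain ⟨v, hv, y, hy, rfl⟩ := Submodule.mem_sup.1
      (hV.sup_eq_top ▸ Submodule.mem_top (x := x))
    obtain ⟨n, hn⟩ := ENNReal.exists_inv_nat_lt hε.ne'
    let i : LinearMap.ker π × ℕ := (⟨y, hy⟩, n)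
    refine ⟨v + w i, V.add_mem hv (hwV (Submodule.subset_span (mem_range_self i))), ?_⟩
    -- The `y` inside `w i` cancels, leaving only the small scaled pole.
    have hdiff : ((v + y : X) : 𝔻 → ℂ) - ((v + w i : X) : 𝔻 → ℂ) =
        -((c i : ℂ) • HardyDisc.onePole (e i)) := by
      rw [← Submodule.coe_sub, add_sub_add_left_eq_sub, sub_add_cancel_left]
      rfl
    rw [hdiff, HardyDisc.gaugeH_neg]
    exact ((hc i).trans_le (ENNReal.inv_le_inv.2 le_self_add)).trans hn
  refine ⟨V.map X.subtype, ?_, fun x => EMetric.mem_closure_iff.2 fun ε hε => ?_⟩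
  · rintro _ ⟨v, hv, rfl⟩
    by_cases hvY : (v : 𝔻 → ℂ) ∈ Y
    · right
      have := Submodule.disjoint_def.1 hV.disjoint v hv ((hπ v).2 hvY)
      simp [this]
    · exact Or.inl ⟨v.2, hvY⟩
  · obtain ⟨u, hu, hlt⟩ := hdense x ε hε
    exact ⟨u, ⟨u, hu, rfl⟩, hlt⟩
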